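/- Let $n \ge 1$ and let $q_0,\dots,q_n$ be positive integers (for example, the dual weights of an invertible pencil of Calabi--Yau hypersurfaces in $\mathbb{P}^n$). Put $d^T = q_0 + \dots + q_n$ and consider the multisets of rational numbers $$\alpha = \{\, j/d^T : 0 \le j < d^T \,\}, \qquad \beta = \{\, j/q_i : 0 \le i \le n,\ 0 \le j < q_i \,\}$$ (with multiplicities), their multiset intersection $I = \alpha \cap \beta$, and the multiset differences $\alpha \smallsetminus I$ and $\beta \smallsetminus I$. Let $k$ be a field of characteristic $0$ (for example $\mathbb{C}$), let $\theta = z\,\frac{d}{dz}$ on $k(z)$, and let $k(z)[\theta]$ be the noncommutative ring of linear differential operators with coefficients in $k(z)$. Then: 1. $a - b \notin \mathbb{Z}$ for all $a \in \alpha \smallsetminus I$ and all $b \in \beta \smallsetminus I$; 2. the hypergeometric Picard--Fuchs equation $$\prod_{b \in \beta \smallsetminus I} (\theta - b) \;-\; z \prod_{a \in \alpha \smallsetminus I} (\theta + a) \;=\; 0$$ is irreducible; that is, the operator on the left-hand side is not a unit of $k(z)[\theta]$ and is not a product of two non-units (equivalently, it has positive order and is not a product of two operators of positive order). -/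

import Mathlib

noncomputable section

open Polynomial

namespace PicardFuchs

section DifferentialOperators

variable (k : Type*) [Field k]

/-- The quotient rule `(p / q)' = (p' q - p q') / q ^ 2`, applied to the reduced fraction. -/
def ratDerivFun (f : RatFunc k) : RatFunc k :=
  algebraMap k[X] (RatFunc k)
      (derivative f.num * f.denom - f.num * derivative f.denom) /
    algebraMap k[X] (RatFunc k) f.denom ^ 2

/-- The quotient rule holds for every way of writing a rational function as a fraction. -/
theorem ratDerivFun_div (p q : k[X]) (hq : q ≠ 0) :
    ratDerivFun k (algebraMap k[X] (RatFunc k) p / algebraMap k[X] (RatFunc k) q) =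
      algebraMap k[X] (RatFunc k) (derivative p * q - p * derivative q) /
        algebraMap k[X] (RatFunc k) q ^ 2 := by
  set f : RatFunc k := algebraMap k[X] (RatFunc k) p / algebraMap k[X] (RatFunc k) q with hf
  have hinj := RatFunc.algebraMap_injective k
  have hq' : algebraMap k[X] (RatFunc k) q ≠ 0 := RatFunc.algebraMap_ne_zero hq
  have hd' : algebraMap k[X] (RatFunc k) f.denom ≠ 0 :=
    RatFunc.algebraMap_ne_zero f.denom_ne_zero
  have h : f.num * q = p * f.denom := by
    apply hinj
    rw [map_mul, map_mul]
    have h1 := f.num_div_denom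
    have h2 : algebraMap k[X] (RatFunc k) f.num / algebraMap k[X] (RatFunc k) f.denom =
        algebraMap k[X] (RatFunc k) p / algebraMap k[X] (RatFunc k) q := by rw [h1]
    rwa [div_eq_div_iff hd' hq'] at h2
  have h' : derivative f.num * q + f.num * derivative q =
      derivative p * f.denom + p * derivative f.denom := by
    have := congrArg derivative h
    simpa [derivative_mul] using this
  unfold ratDerivFun
  rw [div_eq_div_iff (pow_ne_zero 2 hd') (pow_ne_zero 2 hq'), ← map_pow, ← map_pow,
    ← map_mul, ← map_mul]
  congr 1
  linear_combination (f.denom * q) * h' - (derivative f.denom * q + f.denom * derivative q) * h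

/-- The derivation `d/dz` of the field `k(z)` of rational functions. -/
def ratDeriv : Derivation k (RatFunc k) (RatFunc k) :=
  Derivation.mk'
    { toFun := ratDerivFun k
      map_add' := by
        intro f g
        induction f using RatFunc.induction_on with | _ p q hq => ?_
        induction g using RatFunc.induction_on with | _ r s hs => ?_
        have hq' : algebraMap k[X] (RatFunc k) q ≠ 0 := RatFunc.algebraMap_ne_zero hq
        have hs' : algebraMap k[X] (RatFunc k) s ≠ 0 := RatFunc.algebraMap_ne_zero hs
        rw [div_add_div _ _ hq' hs', ← map_mul, ← map_mul, ← map_mul, ← map_add,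
          ratDerivFun_div k _ _ (mul_ne_zero hq hs), ratDerivFun_div k _ _ hq,
          ratDerivFun_div k _ _ hs]
        simp only [derivative_mul, map_add, map_sub, map_mul]
        field_simp
        ring
      map_smul' := by
        intro c f
        induction f using RatFunc.induction_on with | _ p q hq => ?_
        have h : c • (algebraMap k[X] (RatFunc k) p / algebraMap k[X] (RatFunc k) q) =
            algebraMap k[X] (RatFunc k) (C c * p) / algebraMap k[X] (RatFunc k) q := by
          rw [RatFunc.smul_eq_C_mul, map_mul, RatFunc.algebraMap_C, mul_div_assoc]
        rw [h, ratDerivFun_div k _ _ hq, ratDerivFun_div k _ _ hq, RingHom.id_apply,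
          RatFunc.smul_eq_C_mul, ← RatFunc.algebraMap_C, ← mul_div_assoc, ← map_mul]
        congr 2
        simp only [derivative_mul, derivative_C]
        ring }
    (by
      intro f g
      induction f using RatFunc.induction_on with | _ p q hq => ?_
      induction g using RatFunc.induction_on with | _ r s hs => ?_
      have hq' : algebraMap k[X] (RatFunc k) q ≠ 0 := RatFunc.algebraMap_ne_zero hq
      have hs' : algebraMap k[X] (RatFunc k) s ≠ 0 := RatFunc.algebraMap_ne_zero hs
      change ratDerivFun k _ = _ • ratDerivFun k _ + _ • ratDerivFun k _
      rw [div_mul_div_comm, ← map_mul, ← map_mul,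
        ratDerivFun_div k _ _ (mul_ne_zero hq hs), ratDerivFun_div k _ _ hq,
        ratDerivFun_div k _ _ hs]
      simp only [derivative_mul, map_add, map_sub, map_mul, smul_eq_mul]
      field_simp
      ring)

/-- The Euler derivation `z d/dz` of `k(z)`. -/
def eulerDeriv : Derivation k (RatFunc k) (RatFunc k) :=
  (RatFunc.X : RatFunc k) • ratDeriv k

/-- The noncommutative ring `k(z)[θ]` of linear differential operators with rational function
coefficients, `θ = z d/dz`: the `k`-algebra of operators on `k(z)` generated by the
multiplications by rational functions and by `θ`. In characteristic zero the powers of `θ` are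
linearly independent over `k(z)`, so each element is `∑ fᵢ θ ^ i` for unique `fᵢ`, and the units
are the nonzero operators of order `0`. -/
def DiffOp : Subalgebra k (Module.End k (RatFunc k)) :=
  Algebra.adjoin k
    (Set.range (Algebra.lmul k (RatFunc k)) ∪ {(eulerDeriv k : RatFunc k →ₗ[k] RatFunc k)})

/-- The operator `θ = z d/dz`. -/
def theta : DiffOp k :=
  ⟨(eulerDeriv k : RatFunc k →ₗ[k] RatFunc k), Algebra.subset_adjoin (Or.inr rfl)⟩

/-- A rational function as a differential operator of order `0`. -/
def mulOp (f : RatFunc k) : DiffOp k :=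
  ⟨Algebra.lmul k (RatFunc k) f, Algebra.subset_adjoin (Or.inl ⟨f, rfl⟩)⟩

/-- The hypergeometric operator `∏_{b ∈ β} (θ - b) - z ∏_{a ∈ α} (θ + a)`, where `α` and `β` are
multisets of rational numbers. -/
def hypergeometricOp (α β : Multiset ℚ) : DiffOp k :=
  aeval (theta k) (β.map fun b : ℚ => X - C (b : k)).prod -
    mulOp k RatFunc.X * aeval (theta k) (α.map fun a : ℚ => X + C (a : k)).prod

end DifferentialOperators

section Parameters

variable {n : ℕ} (q : Fin (n + 1) → ℕ)

/-- The multiset `α` of the numbers `j / d`, `0 ≤ j < d`, where `d = q₀ + ⋯ + qₙ`. -/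
def alpha : Multiset ℚ :=
  (Multiset.range (∑ i, q i)).map fun j => (j : ℚ) / ((∑ i, q i : ℕ) : ℚ)

/-- The multiset `β` of the numbers `j / qᵢ`, `0 ≤ i ≤ n`, `0 ≤ j < qᵢ`, with multiplicity. -/
def beta : Multiset ℚ :=
  ∑ i, (Multiset.range (q i)).map fun j => (j : ℚ) / (q i : ℚ)

/-- The intersection `I = α ∩ β` of multisets. -/
def common : Multiset ℚ :=
  alpha q ∩ beta q

/-- The Picard–Fuchs operator in hypergeometric form, with parameters `α ∖ I` and `β ∖ I`
(differences of multisets). -/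
def picardFuchsOp (k : Type*) [Field k] : DiffOp k :=
  hypergeometricOp k (alpha q - common q) (beta q - common q)

end Parameters

end PicardFuchs

end

noncomputable section

open Polynomial

namespace PicardFuchs

/-! ### Multiplicities and the symmetry of the parameters under negation modulo the integers -/

section Parameters

/-! After cancelling `I`, no number lies in both parameter multisets, and all parameters lie in `[0,
1)`; this gives the first claim. Both multisets are invariant under `x ↦ -x` modulo `ℤ`, so sums `a
+ b` are non-integral as well. Hence `P = ∏ (X - b)` and `Q = ∏ (X + a)` satisfy `ShiftCoprime`.

Let `L = P(θ) - z Q(θ) = A B`. Clear the denominators of `B` to get `g B = F` with `g ∈ k[z]` and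
`F` a polynomial in `z` over `k[θ]`, then divide by `L` in the variable `z`: `s(θ) F = T L + p(θ)`.

If `p = 0`, torsion-freeness (`ShiftCoprime.exists_eq_ofPoly_mul`) gives `F = T' L`, so `g B = T' A
B`; cancelling `B` shows that `A` is a unit.

If `p ≠ 0`, the left ideal of `B` contains a nonzero polynomial in `θ`. Conjugation by `z` shifts
`θ`, and together with `L = A B` it forces the generator of all such polynomials to be a unit
(`ShiftCoprime.isUnit_of_aeval_mem`), so `B` is a unit. -/

/-- The multiset `{0, 1/r, …, (r-1)/r}` is stable under negation modulo `ℤ`. -/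
theorem count_map_range_div_fract_neg (r : ℕ) {x : ℚ} (h0 : 0 ≤ x) (h1 : x < 1) :
    ((Multiset.range r).map fun j : ℕ => (j : ℚ) / (r : ℚ)).count (Int.fract (-x)) =
      ((Multiset.range r).map fun j : ℕ => (j : ℚ) / (r : ℚ)).count x := by
  rcases Nat.eq_zero_or_pos r with rfl | hr
  · simp
  have hr' : (0 : ℚ) < r := by exact_mod_cast hr
  have hnd : ((Multiset.range r).map fun j : ℕ => (j : ℚ) / (r : ℚ)).Nodup := by
    refine (Multiset.nodup_range r).map ?_
    intro i j hij
    have : (i : ℚ) / r = j / r := hij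
    rw [div_left_inj' hr'.ne'] at this
    exact_mod_cast this
  have key : ∀ y : ℚ, 0 ≤ y → y < 1 →
      y ∈ (Multiset.range r).map (fun j : ℕ => (j : ℚ) / (r : ℚ)) →
      Int.fract (-y) ∈ (Multiset.range r).map (fun j : ℕ => (j : ℚ) / (r : ℚ)) := by
    intro y hy0 hy1 hy
    obtain ⟨j, hj, rfl⟩ := Multiset.mem_map.1 hy
    rw [Multiset.mem_range] at hj
    rw [Multiset.mem_map]
    rcases Nat.eq_zero_or_pos j with rfl | hj0
    · exact ⟨0, by simpa using hr, by simp⟩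
    · refine ⟨r - j, by rw [Multiset.mem_range]; omega, ?_⟩
      symm
      rw [Int.fract_eq_iff]
      have hj0' : (0 : ℚ) < j := by exact_mod_cast hj0
      have hjr : (j : ℚ) < r := by exact_mod_cast hj
      rw [Nat.cast_sub hj.le]
      refine ⟨div_nonneg (by linarith) hr'.le, by rw [div_lt_one hr']; linarith, -1, ?_⟩
      field_simp
      push_cast
      ring
  have hinv : Int.fract (-Int.fract (-x)) = x := by
    rw [Int.fract_eq_iff]
    refine ⟨h0, h1, ⌊-x⌋, ?_⟩
    rw [Int.fract]
    ring
  rw [Multiset.count_eq_of_nodup hnd, Multiset.count_eq_of_nodup hnd]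
  refine if_congr ⟨fun h => ?_, key x h0 h1⟩ rfl rfl
  simpa [hinv] using key _ (Int.fract_nonneg _) (Int.fract_lt_one _) h

variable {n : ℕ} (q : Fin (n + 1) → ℕ)

theorem mem_map_range_div {r : ℕ} {x : ℚ}
    (hx : x ∈ (Multiset.range r).map fun j : ℕ => (j : ℚ) / (r : ℚ)) : 0 ≤ x ∧ x < 1 := by
  obtain ⟨j, hj, rfl⟩ := Multiset.mem_map.1 hx
  rw [Multiset.mem_range] at hj
  have hr' : (0 : ℚ) < r := by exact_mod_cast (Nat.zero_le j).trans_lt hj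
  exact ⟨by positivity, by rw [div_lt_one hr']; exact_mod_cast hj⟩

theorem alpha_eq_map_range : alpha q =
    (Multiset.range (∑ i, q i)).map fun j : ℕ => (j : ℚ) / ((∑ i, q i : ℕ) : ℚ) := by
  simp [alpha, Multiset.pure_def, Multiset.bind_def, Multiset.bind_singleton]

theorem beta_eq_sum_map_range : beta q =
    ∑ i, (Multiset.range (q i)).map fun j : ℕ => (j : ℚ) / (q i : ℚ) := by
  simp [beta, Multiset.pure_def, Multiset.bind_def, Multiset.bind_singleton]

theorem mem_alpha_bounds {a : ℚ} (ha : a ∈ alpha q) : 0 ≤ a ∧ a < 1 :=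
  mem_map_range_div (alpha_eq_map_range q ▸ ha)

theorem mem_beta_bounds {b : ℚ} (hb : b ∈ beta q) : 0 ≤ b ∧ b < 1 := by
  rw [beta_eq_sum_map_range] at hb
  obtain ⟨i, -, hi⟩ := Multiset.mem_sum.1 hb
  exact mem_map_range_div hi

theorem mem_alpha_sub_common {a : ℚ} :
    a ∈ alpha q - common q ↔ (beta q).count a < (alpha q).count a := by
  rw [← Multiset.count_pos, Multiset.count_sub, common, Multiset.count_inter]
  omega

theorem mem_beta_sub_common {b : ℚ} :
    b ∈ beta q - common q ↔ (alpha q).count b < (beta q).count b := by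
  rw [← Multiset.count_pos, Multiset.count_sub, common, Multiset.count_inter]
  omega

theorem count_alpha_fract_neg {x : ℚ} (h0 : 0 ≤ x) (h1 : x < 1) :
    (alpha q).count (Int.fract (-x)) = (alpha q).count x := by
  rw [alpha_eq_map_range]
  exact count_map_range_div_fract_neg _ h0 h1

theorem count_beta_fract_neg {x : ℚ} (h0 : 0 ≤ x) (h1 : x < 1) :
    (beta q).count (Int.fract (-x)) = (beta q).count x := by
  rw [beta_eq_sum_map_range, Multiset.count_sum', Multiset.count_sum']
  exact Finset.sum_congr rfl fun i _ => count_map_range_div_fract_neg _ h0 h1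

theorem alpha_sub_beta_not_int {a b : ℚ} (ha : a ∈ alpha q - common q)
    (hb : b ∈ beta q - common q) (m : ℤ) : a - b ≠ m := by
  intro h
  obtain ⟨ha0, ha1⟩ := mem_alpha_bounds q (Multiset.mem_of_le (Multiset.sub_le_self _ _) ha)
  obtain ⟨hb0, hb1⟩ := mem_beta_bounds q (Multiset.mem_of_le (Multiset.sub_le_self _ _) hb)
  have h1 : (m : ℚ) < 1 := by linarith
  have h2 : (-1 : ℚ) < m := by linarith
  have hm : m = 0 := by
    have : m < 1 := by exact_mod_cast h1
    have : -1 < m := by exact_mod_cast h2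
    omega
  have hab : a = b := by
    rw [hm] at h
    push_cast at h
    linarith
  subst hab
  rw [mem_alpha_sub_common] at ha
  rw [mem_beta_sub_common] at hb
  omega

/-- Negation modulo `ℤ` preserves both multiplicities, so `a` can be replaced by the representative
of `-a` in `[0, 1)`, which turns the sum into a difference. -/
theorem alpha_add_beta_not_int {a b : ℚ} (ha : a ∈ alpha q - common q)
    (hb : b ∈ beta q - common q) (m : ℤ) : a + b ≠ m := by
  intro h
  obtain ⟨ha0, ha1⟩ := mem_alpha_bounds q (Multiset.mem_of_le (Multiset.sub_le_self _ _) ha)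
  have ha' : Int.fract (-a) ∈ alpha q - common q := by
    rw [mem_alpha_sub_common] at ha ⊢
    rwa [count_alpha_fract_neg q ha0 ha1, count_beta_fract_neg q ha0 ha1]
  refine alpha_sub_beta_not_int q ha' hb (-m - ⌊-a⌋) ?_
  rw [Int.fract]
  push_cast
  linarith

/-- The number `0` occurs once for each of the `n + 1 ≥ 2` weights in `β` but at most once in `α`.
This makes the order of the operator positive. -/
theorem beta_sub_common_ne_zero (hn : 1 ≤ n) (hq : ∀ i, 0 < q i) :
    beta q - common q ≠ 0 := by
  have h0 : (0 : ℚ) ∈ beta q - common q := by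
    rw [mem_beta_sub_common]
    have hα : (alpha q).count 0 ≤ 1 := by
      refine Multiset.nodup_iff_count_le_one.1 ?_ 0
      rw [alpha_eq_map_range]
      refine (Multiset.nodup_range _).map ?_
      intro i j hij
      have hd : ((∑ i, q i : ℕ) : ℚ) ≠ 0 := by
        have : 0 < ∑ i, q i := Finset.sum_pos (fun i _ => hq i) Finset.univ_nonempty
        exact_mod_cast this.ne'
      have : (i : ℚ) / ((∑ i, q i : ℕ) : ℚ) = j / ((∑ i, q i : ℕ) : ℚ) := hij
      rw [div_left_inj' hd] at this
      exact_mod_cast this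
    have hβ : n + 1 ≤ (beta q).count 0 := by
      rw [beta_eq_sum_map_range, Multiset.count_sum']
      calc n + 1 = ∑ _i : Fin (n + 1), 1 := by simp
        _ ≤ _ := Finset.sum_le_sum fun i _ => ?_
      rw [Nat.one_le_iff_ne_zero, ← Nat.pos_iff_ne_zero, Multiset.count_pos, Multiset.mem_map]
      exact ⟨0, Multiset.mem_range.2 (hq i), by simp⟩
    omega
  intro h
  rw [h] at h0
  exact Multiset.notMem_zero _ h0

end Parameters

/-! ### Divisibility between integer shifts of polynomials -/

section Shifts

variable {k : Type*} [Field k]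

/-- In characteristic zero a nonzero polynomial has only finitely many shifts by multiples of
`e ≠ 0` that are divisible by a given nonunit. -/
theorem exists_not_dvd_taylor [CharZero k] {p π : k[X]} (hp : p ≠ 0)
    (hπ : ¬ IsUnit π) {e : k} (he : e ≠ 0) : ∃ j : ℕ, ¬ π ∣ taylor ((j : k) * e) p := by
  by_contra! h
  have hdeg : π.degree ≠ 0 := fun h0 => hπ (isUnit_iff_degree_eq_zero.2 h0)
  obtain ⟨c, hc⟩ := IsAlgClosed.exists_aeval_eq_zero (AlgebraicClosure k) π hdeg
  -- A root `c` of `π` would make every `c + j e` a root of `p`.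
  have hroot : ∀ j : ℕ,
      (p.map (algebraMap k (AlgebraicClosure k))).IsRoot
        (c + algebraMap k (AlgebraicClosure k) ((j : k) * e)) := by
    intro j
    obtain ⟨r, hr⟩ := h j
    have h1 := congrArg (aeval c) hr
    rw [map_mul, hc, zero_mul, taylor_apply, aeval_comp] at h1
    rw [IsRoot, eval_map_algebraMap]
    simpa using h1
  have hz := eq_zero_of_infinite_isRoot _ (Set.Infinite.mono (Set.range_subset_iff.2 hroot)
    (Set.infinite_range_of_injective fun i j hij => by
      have := (algebraMap k (AlgebraicClosure k)).injective (add_left_cancel hij)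
      exact_mod_cast mul_right_cancel₀ he this))
  exact hp ((Polynomial.map_eq_zero _).1 hz)

theorem exists_dvd_taylor_of_dvd_mul [CharZero k] {p R π : k[X]} (hp : p ≠ 0) (hπ : Prime π)
    (hπp : π ∣ p) {e : k} (he : e ≠ 0) (h : p ∣ taylor e p * R) :
    ∃ j : ℕ, π ∣ taylor ((j : k) * e) R := by
  classical
  have hex := exists_not_dvd_taylor hp hπ.not_isUnit he
  have hmin := fun m => Nat.find_min hex (m := m)
  have hspec := Nat.find_spec hex
  -- `j + 1` is the first shift of `p` that `π` fails to divide. Shifting the hypothesis by `j e`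
  -- then pushes `π` into the shift of `R`.
  obtain ⟨j, hj⟩ : ∃ j, Nat.find hex = j + 1 := by
    refine Nat.exists_eq_succ_of_ne_zero fun h0 => hspec ?_
    simpa [h0] using hπp
  rw [hj] at hspec hmin
  refine ⟨j, ?_⟩
  have h1 : π ∣ taylor ((j : k) * e) p := not_not.1 (hmin j (Nat.lt_succ_self j))
  have h2 : taylor ((j : k) * e) p ∣ taylor ((j : k) * e) (taylor e p * R) := by
    obtain ⟨c, hc⟩ := h
    exact ⟨taylor ((j : k) * e) c, by rw [hc, taylor_mul]⟩
  rw [taylor_mul, taylor_taylor] at h2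
  refine (hπ.dvd_or_dvd (h1.trans h2)).resolve_left ?_
  rwa [Nat.cast_succ, add_one_mul] at hspec

/-- No integer shifts of `P` and `Q` have a common prime factor. -/
def ShiftCoprime (P Q : k[X]) : Prop :=
  ∀ π : k[X], Prime π → ∀ i j : ℤ, π ∣ taylor (i : k) P → ¬ π ∣ taylor (j : k) Q

/-- A prime factor of `p`, followed along positive shifts, ends up in a shift of `Q`; along negative
shifts it ends up in a shift of `P`. -/
theorem ShiftCoprime.isUnit [CharZero k] {P Q p : k[X]} (h : ShiftCoprime P Q) (hp : p ≠ 0)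
    (hQ : p ∣ taylor 1 p * Q) (hP : p ∣ taylor (-1) p * P) : IsUnit p := by
  by_contra hu
  obtain ⟨π, hπ, hπp⟩ := WfDvdMonoid.exists_irreducible_factor hu hp
  obtain ⟨j, hj⟩ := exists_dvd_taylor_of_dvd_mul hp hπ.prime hπp one_ne_zero hQ
  obtain ⟨i, hi⟩ := exists_dvd_taylor_of_dvd_mul hp hπ.prime hπp (neg_ne_zero.2 one_ne_zero) hP
  exact h π hπ.prime (-i) j (by simpa using hi) (by simpa using hj)

/-- Shifted linear factors of the two products differ by a constant `a + b - (i - j)`, which is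
nonzero and so has no prime divisor. -/
theorem shiftCoprime_of_add_not_int [CharZero k] {α β : Multiset ℚ}
    (h : ∀ a ∈ α, ∀ b ∈ β, ∀ m : ℤ, a + b ≠ m) :
    ShiftCoprime (β.map fun b : ℚ => X - C (b : k)).prod
      (α.map fun a : ℚ => X + C (a : k)).prod := by
  intro π hπ i j hi hj
  have hprod : ∀ (r : k) (s : Multiset ℚ) (f : ℚ → k[X]),
      taylor r (s.map f).prod = (s.map fun x => taylor r (f x)).prod := by
    intro r s f
    have := map_multiset_prod (taylorAlgHom r) (s.map f)
    rwa [Multiset.map_map] at this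
  rw [hprod] at hi hj
  obtain ⟨b, hb, hb'⟩ := hπ.exists_mem_multiset_map_dvd hi
  obtain ⟨a, ha, ha'⟩ := hπ.exists_mem_multiset_map_dvd hj
  have hd := dvd_sub ha' hb'
  have hc : taylor (j : k) (X + C (a : k)) - taylor (i : k) (X - C (b : k)) =
      C ((a + b - ((i - j : ℤ) : ℚ) : ℚ) : k) := by
    rw [map_add, map_sub, taylor_X, taylor_X, taylor_C, taylor_C]
    simp only [Rat.cast_sub, Rat.cast_add, Rat.cast_intCast, Int.cast_sub, map_add, map_sub]
    ring
  rw [hc] at hd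
  refine hπ.not_isUnit (isUnit_of_dvd_unit hd (isUnit_C.2 (IsUnit.mk0 _ ?_)))
  rw [Rat.cast_ne_zero, sub_ne_zero]
  exact h a ha b hb _

end Shifts


/-! ### Polynomials in `z` with coefficients in `k[θ]` on the left -/

section Operators

variable {k : Type*} [Field k]

theorem eulerDeriv_X : eulerDeriv k RatFunc.X = RatFunc.X := by
  have h : ratDeriv k RatFunc.X = 1 := by
    have h1 := ratDerivFun_div k X 1 one_ne_zero
    simp only [map_one, div_one, RatFunc.algebraMap_X, derivative_X, derivative_one, mul_one,
      mul_zero, sub_zero, one_pow] at h1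
    exact h1
  simp [eulerDeriv, h]

theorem eulerDeriv_X_pow (n : ℕ) :
    eulerDeriv k (RatFunc.X ^ n) = (n : k) • (RatFunc.X : RatFunc k) ^ n := by
  rw [Derivation.leibniz_pow, eulerDeriv_X]
  rcases n with _ | n
  · simp
  · rw [Nat.add_sub_cancel, smul_eq_mul, ← pow_succ, Nat.cast_smul_eq_nsmul]

theorem ratDeriv_algebraMap (p : k[X]) :
    ratDeriv k (algebraMap k[X] (RatFunc k) p) =
      algebraMap k[X] (RatFunc k) (derivative p) := by
  have h1 := ratDerivFun_div k p 1 one_ne_zero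
  simp only [map_one, div_one, derivative_one, mul_one, mul_zero, sub_zero, one_pow] at h1
  exact h1

theorem eulerDeriv_algebraMap (p : k[X]) :
    eulerDeriv k (algebraMap k[X] (RatFunc k) p) =
      algebraMap k[X] (RatFunc k) (X * derivative p) := by
  simp [eulerDeriv, ratDeriv_algebraMap]

theorem mulOp_mul (f g : RatFunc k) : mulOp k (f * g) = mulOp k f * mulOp k g :=
  Subtype.ext (map_mul (Algebra.lmul k (RatFunc k)) f g)

theorem mulOp_one : mulOp k 1 = 1 :=
  Subtype.ext (map_one (Algebra.lmul k (RatFunc k)))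

theorem mulOp_mul_inv {f : RatFunc k} (hf : f ≠ 0) : mulOp k f * mulOp k f⁻¹ = 1 := by
  rw [← mulOp_mul, mul_inv_cancel₀ hf, mulOp_one]

theorem mulOp_inv_mul {f : RatFunc k} (hf : f ≠ 0) : mulOp k f⁻¹ * mulOp k f = 1 := by
  rw [← mulOp_mul, inv_mul_cancel₀ hf, mulOp_one]

theorem isUnit_mulOp {f : RatFunc k} (hf : f ≠ 0) : IsUnit (mulOp k f) :=
  ⟨⟨mulOp k f, mulOp k f⁻¹, mulOp_mul_inv hf, mulOp_inv_mul hf⟩, rfl⟩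

theorem theta_mul_mulOp (f : RatFunc k) :
    theta k * mulOp k f = mulOp k f * theta k + mulOp k (eulerDeriv k f) := by
  apply Subtype.ext
  ext g
  change eulerDeriv k (f * g) = f * eulerDeriv k g + eulerDeriv k f * g
  rw [Derivation.leibniz, smul_eq_mul, smul_eq_mul, mul_comm g]

/-- Multiplication by a polynomial in `z` is that polynomial evaluated at the operator `z`. -/
theorem mulOp_algebraMap (p : k[X]) :
    mulOp k (algebraMap k[X] (RatFunc k) p) = aeval (mulOp k RatFunc.X) p := by
  apply Subtype.ext
  rw [aeval_subalgebra_coe]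
  change Algebra.lmul k (RatFunc k) _ = aeval (Algebra.lmul k (RatFunc k) RatFunc.X) p
  rw [aeval_algHom_apply]
  congr 1
  rw [← RatFunc.algebraMap_X, aeval_algebraMap_apply, aeval_X_left_apply]

/-- `p(X - j)`. -/
def shift (j : ℕ) : k[X] →+* k[X] := (taylorAlgHom (-(j : k)) : k[X] →ₐ[k] k[X])

theorem shift_apply (j : ℕ) (p : k[X]) : shift j p = taylor (-(j : k)) p := rfl

theorem shift_shift (i j : ℕ) (p : k[X]) : shift i (shift j p) = shift (i + j) p := by
  simp only [shift_apply, taylor_taylor]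
  congr 2
  push_cast
  ring

theorem shift_zero (p : k[X]) : shift 0 p = p := by
  simp [shift_apply]

theorem shift_injective (j : ℕ) : Function.Injective (shift j : k[X] → k[X]) :=
  taylor_injective _

/-- This is `z θ = (θ - 1) z`, extended to polynomials in `θ`. -/
theorem mulOp_X_mul_aeval (p : k[X]) :
    mulOp k RatFunc.X * aeval (theta k) p = aeval (theta k) (shift 1 p) * mulOp k RatFunc.X := by
  have h : mulOp k RatFunc.X * theta k = (theta k - 1) * mulOp k RatFunc.X := by
    rw [sub_mul, theta_mul_mulOp, eulerDeriv_X, one_mul, add_sub_cancel_right]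
  induction p using Polynomial.induction_on with
  | C a =>
    rw [shift_apply, taylor_C, aeval_C]
    exact (Algebra.commutes a _).symm
  | add p q hp hq => rw [map_add, map_add, map_add, mul_add, add_mul, hp, hq]
  | monomial n a ih =>
    rw [pow_succ, ← mul_assoc, map_mul, ← mul_assoc, ih, mul_assoc, aeval_X, h, ← mul_assoc]
    rw [map_mul (shift 1) _ X, map_mul (aeval (theta k)) _ (shift 1 X)]
    congr 2
    simp [shift_apply, taylor_X, sub_eq_add_neg]

theorem mulOp_X_pow_mul_aeval (j : ℕ) (p : k[X]) :
    mulOp k RatFunc.X ^ j * aeval (theta k) p =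
      aeval (theta k) (shift j p) * mulOp k RatFunc.X ^ j := by
  induction j generalizing p with
  | zero => simp [shift_zero]
  | succ j ih =>
    rw [pow_succ, mul_assoc, mulOp_X_mul_aeval, ← mul_assoc, ih, shift_shift, mul_assoc]

/-- The operator `∑ pⱼ(θ) z ^ j` for `F = ∑ pⱼ Y ^ j`. -/
def ofPoly : k[X][X] →+ DiffOp k :=
  eval₂AddMonoidHom (aeval (theta k) : k[X] →ₐ[k] DiffOp k) (mulOp k RatFunc.X)

theorem ofPoly_monomial (j : ℕ) (p : k[X]) :
    ofPoly (monomial j p) = aeval (theta k) p * mulOp k RatFunc.X ^ j :=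
  eval₂_monomial _ _

theorem ofPoly_C (p : k[X]) : ofPoly (C p) = aeval (theta k) p := by
  rw [← monomial_zero_left, ofPoly_monomial, pow_zero, mul_one]

theorem ofPoly_C_mul (p : k[X]) (F : k[X][X]) :
    ofPoly (C p * F) = aeval (theta k) p * ofPoly F := by
  induction F using Polynomial.induction_on' with
  | add F G hF hG => rw [mul_add, map_add, hF, hG, map_add, mul_add]
  | monomial j r => rw [C_mul_monomial, ofPoly_monomial, ofPoly_monomial, map_mul, mul_assoc]

theorem ofPoly_map_C (p : k[X]) :
    ofPoly (p.map C) = mulOp k (algebraMap k[X] (RatFunc k) p) := by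
  rw [mulOp_algebraMap]
  induction p using Polynomial.induction_on' with
  | add p q hp hq => rw [Polynomial.map_add, map_add, map_add, hp, hq]
  | monomial j a => rw [map_monomial, ofPoly_monomial, aeval_C, aeval_monomial]

/-- The product of `k[θ][z]` in terms of the coefficients on the left. -/
def twistedMul (F G : k[X][X]) : k[X][X] :=
  F.sum fun j p => monomial j p * G.map (shift j)

theorem twistedMul_monomial (j : ℕ) (p : k[X]) (G : k[X][X]) :
    twistedMul (monomial j p) G = monomial j p * G.map (shift j) :=
  sum_monomial_index _ _ (by simp)

theorem add_twistedMul (F F' G : k[X][X]) :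
    twistedMul (F + F') G = twistedMul F G + twistedMul F' G :=
  sum_add_index _ _ _ (by simp) (by simp [add_mul])

theorem twistedMul_add (F G G' : k[X][X]) :
    twistedMul F (G + G') = twistedMul F G + twistedMul F G' := by
  simp only [twistedMul, Polynomial.map_add, mul_add, sum_def, Finset.sum_add_distrib]

theorem ofPoly_mul (F G : k[X][X]) : ofPoly F * ofPoly G = ofPoly (twistedMul F G) := by
  induction F using Polynomial.induction_on' with
  | add F F' hF hF' => rw [map_add, add_mul, hF, hF', add_twistedMul, map_add]
  | monomial j p =>
    induction G using Polynomial.induction_on' with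
    | add G G' hG hG' => rw [map_add, mul_add, hG, hG', twistedMul_add, map_add]
    | monomial i r =>
      rw [twistedMul_monomial, map_monomial, monomial_mul_monomial, ofPoly_monomial,
        ofPoly_monomial, ofPoly_monomial, map_mul, pow_add, mul_assoc, ← mul_assoc (_ ^ j),
        mulOp_X_pow_mul_aeval]
      simp only [mul_assoc]

/-- The top coefficient is the product of one leading coefficient with a shift of the other, and
shifts are injective. -/
theorem twistedMul_ne_zero {F G : k[X][X]} (hF : F ≠ 0) (hG : G ≠ 0) : twistedMul F G ≠ 0 := by
  have hcoeff : (twistedMul F G).coeff (F.natDegree + G.natDegree) =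
      F.leadingCoeff * shift F.natDegree G.leadingCoeff := by
    rw [twistedMul, sum_def, finsetSum_coeff, Finset.sum_eq_single F.natDegree]
    · rw [← C_mul_X_pow_eq_monomial, mul_assoc, coeff_C_mul, add_comm, coeff_X_pow_mul,
        coeff_map, leadingCoeff, leadingCoeff]
    · intro j hj hne
      have hlt : j < F.natDegree := lt_of_le_of_ne (le_natDegree_of_mem_supp j hj) hne
      apply coeff_eq_zero_of_natDegree_lt
      calc _ ≤ _ := natDegree_mul_le
        _ ≤ j + G.natDegree := add_le_add (natDegree_monomial_le _) natDegree_map_le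
        _ < _ := by omega
    · intro h
      rw [notMem_support_iff.1 h]
      simp
  intro h0
  rw [h0, coeff_zero] at hcoeff
  refine mul_ne_zero (leadingCoeff_ne_zero.2 hF) ?_ hcoeff.symm
  exact (map_ne_zero_iff _ (shift_injective _)).2 (leadingCoeff_ne_zero.2 hG)

theorem aeval_theta_apply_X_pow (p : k[X]) (n : ℕ) :
    (aeval (theta k) p : DiffOp k).1 (RatFunc.X ^ n) =
      p.eval (n : k) • (RatFunc.X : RatFunc k) ^ n := by
  rw [aeval_subalgebra_coe]
  refine Module.End.aeval_apply_of_hasEigenvector ⟨?_, pow_ne_zero _ RatFunc.X_ne_zero⟩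
  rw [Module.End.mem_eigenspace_iff]
  exact eulerDeriv_X_pow n

theorem ofPoly_apply_X_pow (F : k[X][X]) (n : ℕ) :
    (ofPoly F).1 (RatFunc.X ^ n) = algebraMap k[X] (RatFunc k)
      (F.sum fun j p => monomial (n + j) (p.eval ((n + j : ℕ) : k))) := by
  induction F using Polynomial.induction_on' with
  | add F G hF hG =>
    rw [map_add, sum_add_index _ _ _ (by simp) (by simp), map_add, ← hF, ← hG]
    rfl
  | monomial j p =>
    rw [sum_monomial_index _ _ (by simp), ofPoly_monomial]
    have h : (mulOp k RatFunc.X ^ j).1 (RatFunc.X ^ n) = (RatFunc.X : RatFunc k) ^ (n + j) := by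
      have h1 : mulOp k RatFunc.X ^ j = mulOp k (RatFunc.X ^ j) :=
        Subtype.ext (map_pow (Algebra.lmul k (RatFunc k)) _ _).symm
      rw [h1, add_comm, pow_add]
      rfl
    change (aeval (theta k) p : DiffOp k).1 ((mulOp k RatFunc.X ^ j).1 (RatFunc.X ^ n)) = _
    rw [h, aeval_theta_apply_X_pow, ← C_mul_X_pow_eq_monomial, map_mul, map_pow,
      RatFunc.algebraMap_X, RatFunc.algebraMap_C, RatFunc.smul_eq_C_mul]

variable [CharZero k]

/-- Applied to `z ^ n`, the operator has `z ^ (n + j)`-coefficient `pⱼ(n + j)`. If it vanishes for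
all `n`, then `pⱼ` has infinitely many roots in characteristic zero. -/
theorem ofPoly_injective : Function.Injective (ofPoly : k[X][X] →+ DiffOp k) := by
  rw [injective_iff_map_eq_zero]
  intro F hF
  ext1 j
  rw [coeff_zero]
  refine eq_zero_of_infinite_isRoot _ (Set.Infinite.mono
    (s := Set.range fun n : ℕ => ((n + j : ℕ) : k)) ?_
    (Set.infinite_range_of_injective fun a b hab => by
      have : a + j = b + j := Nat.cast_injective hab
      omega))
  rintro _ ⟨n, rfl⟩
  have h1 := ofPoly_apply_X_pow F n
  rw [hF] at h1
  have h2 := RatFunc.algebraMap_injective k (h1.symm.trans (map_zero (algebraMap _ _)).symm)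
  have h3 := congrArg (fun p => coeff p (n + j)) h2
  simp only [sum_def, finsetSum_coeff, coeff_monomial, coeff_zero] at h3
  rw [Finset.sum_eq_single j] at h3
  · simpa using h3
  · intro i _ hi
    rw [if_neg (by omega)]
  · intro h
    rw [notMem_support_iff.1 h]
    simp

theorem ofPoly_eq_zero_iff {F : k[X][X]} : ofPoly F = 0 ↔ F = 0 :=
  map_eq_zero_iff _ ofPoly_injective

end Operators


/-! ### Clearing denominators, and absence of zero divisors -/

section Denominators

variable {k : Type*} [Field k]

/-- `d` becomes an element of `k[z][θ]` after multiplication by a nonzero polynomial in `z`. -/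
def HasDenominator (d : DiffOp k) : Prop :=
  ∃ g : k[X], g ≠ 0 ∧ ∃ F : k[X][X], mulOp k (algebraMap k[X] (RatFunc k) g) * d = ofPoly F

theorem HasDenominator.add {d e : DiffOp k} (hd : HasDenominator d) (he : HasDenominator e) :
    HasDenominator (d + e) := by
  obtain ⟨g, hg, F, hF⟩ := hd
  obtain ⟨h, hh, G, hG⟩ := he
  refine ⟨g * h, mul_ne_zero hg hh,
    twistedMul (h.map C) F + twistedMul (g.map C) G, ?_⟩
  rw [map_add, ← ofPoly_mul, ← ofPoly_mul, ofPoly_map_C, ofPoly_map_C, ← hF, ← hG, mul_add,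
    ← mul_assoc, ← mul_assoc, ← mulOp_mul, ← mulOp_mul, ← map_mul, ← map_mul, mul_comm h g]

theorem HasDenominator.mulOp_mul {d : DiffOp k} (hd : HasDenominator d) (f : RatFunc k) :
    HasDenominator (mulOp k f * d) := by
  obtain ⟨g, hg, F, hF⟩ := hd
  refine ⟨g * f.denom, mul_ne_zero hg f.denom_ne_zero, twistedMul (f.num.map C) F, ?_⟩
  have hd : algebraMap k[X] (RatFunc k) f.denom ≠ 0 :=
    RatFunc.algebraMap_ne_zero f.denom_ne_zero
  rw [← ofPoly_mul, ofPoly_map_C, ← hF, ← mul_assoc, ← mul_assoc, ← PicardFuchs.mulOp_mul,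
    ← PicardFuchs.mulOp_mul]
  congr 2
  have hf := f.num_div_denom
  rw [div_eq_iff hd] at hf
  rw [map_mul, hf]
  ring

theorem HasDenominator.theta_mul {d : DiffOp k} (hd : HasDenominator d) :
    HasDenominator (theta k * d) := by
  obtain ⟨g, hg, F, hF⟩ := hd
  refine ⟨g * g, mul_ne_zero hg hg,
    -- From `θ g = g θ + z g'` one gets `g² θ d = g θ (g d) - z g' (g d)`.
    twistedMul (g.map C) (C X * F) - twistedMul ((X * derivative g).map C) F, ?_⟩
  rw [map_sub, ← ofPoly_mul, ← ofPoly_mul, ofPoly_C_mul, ofPoly_map_C, ofPoly_map_C, ← hF,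
    aeval_X, ← mul_assoc (theta k), theta_mul_mulOp, eulerDeriv_algebraMap, map_mul,
    PicardFuchs.mulOp_mul, add_mul, mul_add]
  have hc : mulOp k (algebraMap k[X] (RatFunc k) g) *
      mulOp k (algebraMap k[X] (RatFunc k) (X * derivative g)) =
      mulOp k (algebraMap k[X] (RatFunc k) (X * derivative g)) *
      mulOp k (algebraMap k[X] (RatFunc k) g) := by
    rw [← PicardFuchs.mulOp_mul, ← PicardFuchs.mulOp_mul, mul_comm]
  have hc' := congrArg (· * d) hc
  simp only [mul_assoc] at hc' ⊢
  rw [hc', add_sub_cancel_right]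

theorem hasDenominator (d : DiffOp k) : HasDenominator d := by
  -- Stating closure under left multiplication for every `d` reduces the product case to
  -- composition.
  have h : ∀ x (hx : x ∈ DiffOp k), ∀ d : DiffOp k, HasDenominator d →
      HasDenominator ((⟨x, hx⟩ : DiffOp k) * d) := by
    intro x hx
    refine Algebra.adjoin_induction (p := fun x hx => ∀ d : DiffOp k, HasDenominator d →
      HasDenominator ((⟨x, hx⟩ : DiffOp k) * d)) ?_ ?_ ?_ ?_ hx
    · rintro x (⟨f, rfl⟩ | rfl) d hd
      · exact hd.mulOp_mul f
      · exact hd.theta_mul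
    · intro r d hd
      have : (⟨algebraMap k _ r, Subalgebra.algebraMap_mem _ r⟩ : DiffOp k) =
          mulOp k (algebraMap k (RatFunc k) r) :=
        Subtype.ext (AlgHom.commutes (Algebra.lmul k (RatFunc k)) r).symm
      rw [this]
      exact hd.mulOp_mul _
    · intro x y hx hy ihx ihy d hd
      have : (⟨x + y, add_mem hx hy⟩ : DiffOp k) * d =
          (⟨x, hx⟩ : DiffOp k) * d + (⟨y, hy⟩ : DiffOp k) * d :=
        add_mul (⟨x, hx⟩ : DiffOp k) ⟨y, hy⟩ d
      rw [this]
      exact (ihx d hd).add (ihy d hd)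
    · intro x y hx hy ihx ihy d hd
      have : (⟨x * y, mul_mem hx hy⟩ : DiffOp k) * d =
          (⟨x, hx⟩ : DiffOp k) * ((⟨y, hy⟩ : DiffOp k) * d) :=
        mul_assoc (⟨x, hx⟩ : DiffOp k) ⟨y, hy⟩ d
      rw [this]
      exact ihx _ (ihy d hd)
  have h1 : HasDenominator (1 : DiffOp k) :=
    ⟨1, one_ne_zero, C 1, by rw [ofPoly_C, map_one, map_one, mulOp_one, one_mul]⟩
  have := h d.1 d.2 1 h1
  rwa [mul_one] at this

theorem isUnit_mulOp_algebraMap {g : k[X]} (hg : g ≠ 0) :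
    IsUnit (mulOp k (algebraMap k[X] (RatFunc k) g)) :=
  isUnit_mulOp (RatFunc.algebraMap_ne_zero hg)

variable [CharZero k]

instance : NoZeroDivisors (DiffOp k) where
  eq_zero_or_eq_zero_of_mul_eq_zero := by
    intro A B hAB
    obtain ⟨g, hg, F, hF⟩ := hasDenominator B
    obtain ⟨u, hu⟩ := isUnit_mulOp_algebraMap hg
    -- The inverse of the denominator of `B` is absorbed into `A`, so that it cancels in `G F = h A
    -- u⁻¹ u B`.
    obtain ⟨h, hh, G, hG⟩ := hasDenominator (A * (↑u⁻¹ : DiffOp k))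
    have hFG : ofPoly G * ofPoly F = 0 := by
      rw [← hF, ← hG, ← hu, mul_assoc, mul_assoc, Units.inv_mul_cancel_left, hAB, mul_zero]
    rw [ofPoly_mul, ofPoly_eq_zero_iff] at hFG
    by_cases hF0 : F = 0
    · right
      rw [hF0, map_zero] at hF
      exact (isUnit_mulOp_algebraMap hg).mul_right_eq_zero.1 hF
    · left
      have hG0 : G = 0 := by
        by_contra hG0
        exact twistedMul_ne_zero hG0 hF0 hFG
      rw [hG0, map_zero, (isUnit_mulOp_algebraMap hh).mul_right_eq_zero,
        (Units.isUnit u⁻¹).mul_left_eq_zero] at hG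
      exact hG

theorem isUnit_of_mul_eq_one_left {B C : DiffOp k} (h : C * B = 1) : IsUnit B := by
  have hB : B ≠ 0 := by
    rintro rfl
    rw [mul_zero] at h
    exact zero_ne_one h
  have h2 : (B * C - 1) * B = 0 := by
    rw [sub_mul, mul_assoc, h, mul_one, one_mul, sub_self]
  have h3 := (mul_eq_zero.1 h2).resolve_right hB
  exact ⟨⟨B, C, sub_eq_zero.1 h3, h⟩, rfl⟩

end Denominators


/-! ### Irreducibility of `P(θ) - z Q(θ)` -/

section Irreducibility

variable {k : Type*} [Field k]

/-- The operator `P(θ) - z Q(θ)`. -/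
def twoTermOp (P Q : k[X]) : DiffOp k :=
  aeval (theta k) P - mulOp k RatFunc.X * aeval (theta k) Q

theorem coeff_twistedMul_C (F : k[X][X]) (P : k[X]) (n : ℕ) :
    (twistedMul F (C P)).coeff n = F.coeff n * shift n P := by
  induction F using Polynomial.induction_on' with
  | add F G hF hG => rw [add_twistedMul, coeff_add, hF, hG, coeff_add, add_mul]
  | monomial j p =>
    rw [twistedMul_monomial, map_C, coeff_mul_C, coeff_monomial]
    split_ifs with h
    · rw [h]
    · simp

theorem coeff_twistedMul_monomial_one (F : k[X][X]) (R : k[X]) :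
    (twistedMul F (monomial 1 R)).coeff 0 = 0 ∧
      ∀ n, (twistedMul F (monomial 1 R)).coeff (n + 1) = F.coeff n * shift n R := by
  induction F using Polynomial.induction_on' with
  | add F G hF hG =>
    rw [add_twistedMul]
    refine ⟨by rw [coeff_add, hF.1, hG.1, add_zero], fun n => ?_⟩
    rw [coeff_add, hF.2, hG.2, coeff_add, add_mul]
  | monomial j p =>
    rw [twistedMul_monomial, map_monomial, monomial_mul_monomial]
    refine ⟨by rw [coeff_monomial, if_neg (Nat.succ_ne_zero j)], fun n => ?_⟩
    rw [coeff_monomial, coeff_monomial]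
    by_cases h : j = n
    · subst h
      simp
    · rw [if_neg (by omega), if_neg h, zero_mul]

theorem exists_ofPoly_mul_twoTermOp (P Q : k[X]) (F : k[X][X]) :
    ∃ G : k[X][X], ofPoly F * twoTermOp P Q = ofPoly G ∧ G.coeff 0 = F.coeff 0 * P ∧
      ∀ n, G.coeff (n + 1) =
        F.coeff (n + 1) * shift (n + 1) P - F.coeff n * shift (n + 1) Q := by
  refine ⟨twistedMul F (C P) - twistedMul F (monomial 1 (shift 1 Q)), ?_, ?_, fun n => ?_⟩
  · rw [map_sub, ← ofPoly_mul, ← ofPoly_mul, ofPoly_C, ofPoly_monomial, pow_one,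
      ← mulOp_X_mul_aeval, twoTermOp, mul_sub]
  · rw [coeff_sub, coeff_twistedMul_C, (coeff_twistedMul_monomial_one _ _).1, shift_zero,
      sub_zero]
  · rw [coeff_sub, coeff_twistedMul_C, (coeff_twistedMul_monomial_one _ _).2, shift_shift]

theorem natDegree_shift (j : ℕ) (P : k[X]) : (shift j P).natDegree = P.natDegree :=
  natDegree_taylor _ _

/-- Division with remainder by `P(θ) - z Q(θ)` in the variable `z`, up to a factor in `k[θ]`. -/
theorem exists_aeval_mul_ofPoly_eq (P : k[X]) {Q : k[X]} (hQ : Q ≠ 0) (N : ℕ) (F : k[X][X])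
    (hF : F.natDegree ≤ N) :
    ∃ s : k[X], s ≠ 0 ∧ ∃ (T : k[X][X]) (p : k[X]),
      aeval (theta k) s * ofPoly F = ofPoly T * twoTermOp P Q + aeval (theta k) p := by
  induction N generalizing F with
  | zero =>
    refine ⟨1, one_ne_zero, 0, F.coeff 0, ?_⟩
    rw [map_one, one_mul, map_zero, zero_mul, zero_add, ← ofPoly_C,
      ← eq_C_of_natDegree_le_zero hF]
  | succ N ih =>
    -- The top coefficient of this multiple of the operator is `-F.coeff (N + 1) * shift (N + 1) Q`,
    -- so adding it to `shift (N + 1) Q` times `F` kills the term of degree `N + 1`.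
    obtain ⟨G, hG, -, hGs⟩ := exists_ofPoly_mul_twoTermOp P Q (monomial N (F.coeff (N + 1)))
    obtain ⟨s, hs, T, p, h⟩ := ih (C (shift (N + 1) Q) * F + G) (by
      rw [natDegree_le_iff_coeff_eq_zero]
      intro m hm
      obtain ⟨m, rfl⟩ : ∃ m', m = m' + 1 := ⟨m - 1, by omega⟩
      rw [coeff_add, coeff_C_mul, hGs, coeff_monomial, coeff_monomial, if_neg (by omega)]
      by_cases h : N = m
      · subst h
        rw [if_pos rfl]
        ring
      · rw [if_neg h, coeff_eq_zero_of_natDegree_lt (by omega)]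
        ring)
    refine ⟨s * shift (N + 1) Q,
      mul_ne_zero hs ((map_ne_zero_iff _ (shift_injective _)).2 hQ),
      T - C s * monomial N (F.coeff (N + 1)), p, ?_⟩
    rw [map_add, ofPoly_C_mul, ← hG, mul_add, ← mul_assoc, ← mul_assoc, ← map_mul,
      ← eq_sub_iff_add_eq] at h
    rw [h, map_sub, ofPoly_C_mul, sub_mul]
    abel

/-- A Gauss lemma. If `π` divides no backward shift of `P`, the recursion is solved upwards from the
constant coefficient; otherwise `π` divides no backward shift of `Q`, and it is solved downwards
from the vanishing coefficient just above the degree. -/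
theorem ShiftCoprime.dvd_coeff {P Q π : k[X]} (h : ShiftCoprime P Q) (hπ : Prime π)
    (T : k[X][X]) (h0 : π ∣ T.coeff 0 * P)
    (hs : ∀ n, π ∣ T.coeff (n + 1) * shift (n + 1) P - T.coeff n * shift (n + 1) Q) (n : ℕ) :
    π ∣ T.coeff n := by
  by_cases hP : ∀ j : ℕ, ¬ π ∣ shift j P
  · induction n with
    | zero =>
      refine (hπ.dvd_or_dvd h0).resolve_right ?_
      simpa only [shift_zero] using hP 0
    | succ n ih =>
      have h1 := dvd_add (hs n) (ih.mul_right (shift (n + 1) Q))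
      rw [sub_add_cancel] at h1
      exact (hπ.dvd_or_dvd h1).resolve_right (hP _)
  · push Not at hP
    obtain ⟨i, hi⟩ := hP
    have hQ : ∀ j : ℕ, ¬ π ∣ shift j Q := by
      intro j
      have := h π hπ (-i) (-j)
      simp only [Int.cast_neg, Int.cast_natCast] at this
      exact this hi
    by_cases hn : T.natDegree < n
    · rw [coeff_eq_zero_of_natDegree_lt hn]
      exact dvd_zero _
    · have hle : n ≤ T.natDegree + 1 := by omega
      induction hle using Nat.decreasingInduction with
      | self =>
        rw [coeff_eq_zero_of_natDegree_lt (Nat.lt_succ_self _)]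
        exact dvd_zero _
      | of_succ m hm ih =>
        have ih' : π ∣ T.coeff (m + 1) := by
          by_cases hm' : T.natDegree < m + 1
          · rw [coeff_eq_zero_of_natDegree_lt hm']
            exact dvd_zero _
          · exact ih hm'
        have h1 := dvd_sub (ih'.mul_right (shift (m + 1) P)) (hs m)
        rw [sub_sub_cancel] at h1
        exact (hπ.dvd_or_dvd h1).resolve_right (hQ _)

variable [CharZero k]

theorem twoTermOp_ne_zero {P : k[X]} (hP : 0 < P.natDegree) (Q : k[X]) :
    twoTermOp P Q ≠ 0 := by
  intro h
  obtain ⟨G, hG, hG0, -⟩ := exists_ofPoly_mul_twoTermOp P Q (C 1)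
  rw [h, mul_zero, eq_comm, ofPoly_eq_zero_iff] at hG
  rw [hG, coeff_zero, coeff_C_zero, one_mul] at hG0
  rw [← hG0, natDegree_zero] at hP
  exact hP.false

/-- Clearing denominators of an inverse gives `F L = g(z)`, whose coefficients have degree `0` in
`θ`. Since `P` has positive degree, the coefficients of `F` vanish one after another. -/
theorem not_isUnit_twoTermOp {P : k[X]} (hP : 0 < P.natDegree) (Q : k[X]) :
    ¬ IsUnit (twoTermOp P Q) := by
  rintro ⟨u, hu⟩
  obtain ⟨g, hg, F, hF⟩ := hasDenominator (↑u⁻¹ : DiffOp k)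
  obtain ⟨G, hG, hG0, hGs⟩ := exists_ofPoly_mul_twoTermOp P Q F
  have hGg : G = g.map C := by
    apply ofPoly_injective
    rw [← hG, ← hF, ← hu, mul_assoc, Units.inv_mul, mul_one, ofPoly_map_C]
  have key : ∀ (n : ℕ) (f : k[X]) (c : k), C c = f * shift n P → f = 0 := by
    intro n f c h
    by_contra hf
    have h1 := congrArg natDegree h
    have hP' : shift n P ≠ 0 := by
      intro h0
      rw [← natDegree_shift n, h0] at hP
      simp at hP
    rw [natDegree_C, natDegree_mul hf hP', natDegree_shift] at h1
    omega
  have hzero : ∀ n, F.coeff n = 0 := by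
    intro n
    induction n with
    | zero =>
      refine key 0 _ (g.coeff 0) ?_
      rw [shift_zero, ← hG0, hGg, coeff_map]
    | succ n ih =>
      refine key (n + 1) _ (g.coeff (n + 1)) ?_
      have := hGs n
      rw [ih, zero_mul, sub_zero] at this
      rw [← this, hGg, coeff_map]
  have hF0 : F = 0 := by
    ext1 n
    rw [hzero, coeff_zero]
  rw [hF0, map_zero, (isUnit_mulOp_algebraMap hg).mul_right_eq_zero] at hF
  exact u⁻¹.ne_zero hF

/-- The module `k[θ][z] / k[θ][z] (P(θ) - z Q(θ))` has no `k[θ]`-torsion. -/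
theorem ShiftCoprime.exists_eq_ofPoly_mul {P Q : k[X]} (h : ShiftCoprime P Q) (s : k[X])
    (hs : s ≠ 0) (F T : k[X][X])
    (hFT : aeval (theta k) s * ofPoly F = ofPoly T * twoTermOp P Q) :
    ∃ T' : k[X][X], ofPoly F = ofPoly T' * twoTermOp P Q := by
  -- One prime factor of `s` is removed at a time: it divides every coefficient of `T`, hence
  -- cancels.
  induction s using UniqueFactorizationMonoid.induction_on_prime generalizing T with
  | h₁ => exact absurd rfl hs
  | h₂ s hu =>
    obtain ⟨u, rfl⟩ := hu
    refine ⟨C (↑u⁻¹ : k[X]) * T, ?_⟩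
    rw [ofPoly_C_mul, mul_assoc, ← hFT, ← mul_assoc, ← map_mul, Units.inv_mul, map_one, one_mul]
  | h₃ s π hs0 hπ ih =>
    obtain ⟨G, hG, hG0, hGs⟩ := exists_ofPoly_mul_twoTermOp P Q T
    have hG' : G = C π * (C s * F) := by
      apply ofPoly_injective
      rw [← hG, ← hFT, ofPoly_C_mul, ofPoly_C_mul, map_mul, mul_assoc]
    have hdvd : C π ∣ T := by
      rw [C_dvd_iff_dvd_coeff]
      refine h.dvd_coeff hπ T ?_ fun n => ?_
      · rw [← hG0, hG', coeff_C_mul]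
        exact dvd_mul_right _ _
      · rw [← hGs, hG', coeff_C_mul]
        exact dvd_mul_right _ _
    obtain ⟨T', rfl⟩ := hdvd
    refine ih hs0 T' ?_
    rw [ofPoly_C_mul, map_mul, mul_assoc, mul_assoc] at hFT
    refine mul_left_cancel₀ ?_ hFT
    rw [← ofPoly_C, Ne, ofPoly_eq_zero_iff, C_eq_zero]
    exact hπ.ne_zero

theorem ShiftCoprime.isUnit_of_aeval_mem {P Q : k[X]} (h : ShiftCoprime P Q) {B : DiffOp k}
    (hB : ∃ A, twoTermOp P Q = A * B) {p : k[X]} (hp : p ≠ 0)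
    (hpB : ∃ A, aeval (theta k) p = A * B) : IsUnit B := by
  let I : Ideal k[X] :=
    { carrier := {r | ∃ A, aeval (theta k) r = A * B}
      add_mem' := by
        rintro r s ⟨A, hA⟩ ⟨A', hA'⟩
        exact ⟨A + A', by rw [map_add, hA, hA', add_mul]⟩
      zero_mem' := ⟨0, by rw [map_zero, zero_mul]⟩
      smul_mem' := by
        rintro c r ⟨A, hA⟩
        exact ⟨aeval (theta k) c * A, by rw [smul_eq_mul, map_mul, hA, mul_assoc]⟩ }
  have hmem : ∀ r, r ∈ I ↔ ∃ A, aeval (theta k) r = A * B := fun r => Iff.rfl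
  obtain ⟨g, hg⟩ := IsPrincipalIdealRing.principal I
  have hdvd : ∀ r, r ∈ I ↔ g ∣ r := fun r => by
    rw [hg]
    exact Ideal.mem_span_singleton
  have hg0 : g ≠ 0 := by
    rintro rfl
    exact hp (zero_dvd_iff.1 ((hdvd p).1 hpB))
  obtain ⟨A, hA⟩ := (hmem g).1 ((hdvd g).2 dvd_rfl)
  obtain ⟨L, hL⟩ := hB
  have hgL : aeval (theta k) P = L * B + mulOp k RatFunc.X * aeval (theta k) Q := by
    rw [← hL, twoTermOp, sub_add_cancel]
  have hz := mulOp_inv_mul (k := k) RatFunc.X_ne_zero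
  have hshift : shift 1 (taylor 1 g) = g := by
    rw [shift_apply, taylor_taylor]
    simp
  have hu : IsUnit g := by
    refine h.isUnit hg0 ?_ ?_
    -- With `L` now the left cofactor of `B`: `z g(θ + 1) Q(θ) = g(θ) z Q(θ) = P(θ) g(θ) - g(θ) L
    -- B`, and `z` is invertible.
    · rw [← hdvd, hmem]
      refine ⟨mulOp k RatFunc.X⁻¹ * (aeval (theta k) P * A - aeval (theta k) g * L), ?_⟩
      have h1 : mulOp k RatFunc.X * aeval (theta k) (taylor 1 g * Q) =
          (aeval (theta k) P * A - aeval (theta k) g * L) * B := by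
        rw [map_mul, ← mul_assoc, mulOp_X_mul_aeval, hshift, mul_assoc,
          ← sub_eq_iff_eq_add'.2 hgL, mul_sub, ← map_mul, mul_comm g P, map_mul, hA, sub_mul]
        simp only [mul_assoc]
      rw [mul_assoc, ← h1, ← mul_assoc, hz, one_mul]
    -- Here `g(θ - 1) P(θ) = g(θ - 1) L B + z Q(θ) g(θ)`.
    · rw [← hdvd, hmem]
      have ht : taylor (-1) g = shift 1 g := by simp [shift_apply]
      refine ⟨aeval (theta k) (shift 1 g) * L +
        mulOp k RatFunc.X * (aeval (theta k) Q * A), ?_⟩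
      rw [ht, map_mul, hgL, mul_add, ← mul_assoc, ← mul_assoc, ← mulOp_X_mul_aeval, mul_assoc _ _
        (aeval (theta k) Q), ← map_mul, mul_comm g Q, map_mul, hA, add_mul]
      simp only [mul_assoc]
  obtain ⟨C, hC⟩ := (hmem 1).1 ((hdvd 1).2 hu.dvd)
  exact isUnit_of_mul_eq_one_left (C := C) (by rw [← hC, map_one])

theorem ShiftCoprime.irreducible_twoTermOp {P Q : k[X]} (h : ShiftCoprime P Q)
    (hP : 0 < P.natDegree) (hQ : Q ≠ 0) : Irreducible (twoTermOp P Q) := by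
  refine ⟨not_isUnit_twoTermOp hP Q, fun A B hAB => ?_⟩
  obtain ⟨g, hg, F, hF⟩ := hasDenominator B
  obtain ⟨s, hs, T, p, hsT⟩ := exists_aeval_mul_ofPoly_eq P hQ _ F le_rfl
  by_cases hp : p = 0
  · left
    rw [hp, map_zero, add_zero] at hsT
    obtain ⟨T', hT'⟩ := h.exists_eq_ofPoly_mul s hs F T hsT
    have hB : B ≠ 0 := by
      rintro rfl
      rw [mul_zero] at hAB
      exact twoTermOp_ne_zero hP Q hAB
    obtain ⟨u, hu⟩ := isUnit_mulOp_algebraMap hg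
    have h1 : mulOp k (algebraMap k[X] (RatFunc k) g) = ofPoly T' * A := by
      refine mul_right_cancel₀ hB ?_
      rw [hF, hT', hAB, mul_assoc]
    refine isUnit_of_mul_eq_one_left (C := (↑u⁻¹ : DiffOp k) * ofPoly T') ?_
    rw [mul_assoc, ← h1, ← hu, Units.inv_mul]
  · right
    refine h.isUnit_of_aeval_mem ⟨A, hAB⟩ hp
      ⟨aeval (theta k) s * mulOp k (algebraMap k[X] (RatFunc k) g) - ofPoly T * A, ?_⟩
    rw [sub_mul, mul_assoc, mul_assoc, hF, ← hAB, hsT, add_sub_cancel_left]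

theorem irreducible_hypergeometricOp {α β : Multiset ℚ} (hβ : β ≠ 0)
    (h : ∀ a ∈ α, ∀ b ∈ β, ∀ m : ℤ, a + b ≠ m) : Irreducible (hypergeometricOp k α β) := by
  refine (shiftCoprime_of_add_not_int h).irreducible_twoTermOp ?_ ?_
  · rw [show (fun b : ℚ => X - C (b : k)) = (fun x : k => X - C x) ∘ (Rat.cast : ℚ → k) from rfl,
      ← Multiset.map_map, natDegree_multiset_prod_X_sub_C_eq_card, Multiset.card_map]
    exact Multiset.card_pos.2 hβ
  · exact (monic_multiset_prod_of_monic α (fun a : ℚ => X + C (a : k))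
      fun a _ => monic_X_add_C (a : k)).ne_zero

end Irreducibility

end PicardFuchs

end

theorem mainTheorem9 (k : Type*) [Field k] [CharZero k] (n : ℕ) (hn : 1 ≤ n)
    (q : Fin (n + 1) → ℕ) (hq : ∀ i, 0 < q i) :
    (∀ a ∈ PicardFuchs.alpha q - PicardFuchs.common q,
      ∀ b ∈ PicardFuchs.beta q - PicardFuchs.common q, ∀ m : ℤ, a - b ≠ (m : ℚ)) ∧
    Irreducible (PicardFuchs.picardFuchsOp q k) :=
  ⟨fun _ ha _ hb m => PicardFuchs.alpha_sub_beta_not_int q ha hb m,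
    PicardFuchs.irreducible_hypergeometricOp (PicardFuchs.beta_sub_common_ne_zero q hn hq)
      fun _ ha _ hb m => PicardFuchs.alpha_add_beta_not_int q ha hb m⟩
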